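/- Let $\mathbf A=(a_{ij})_{i,j\ge 0}$ be the infinite real matrix with entries \[ a_{00}=\tfrac12,\qquad a_{01}=-1,\qquad a_{0j}=0\ (j\ge 2), \] \[ a_{10}=\frac{\pi^2}{12}+\sum_{k=1}^\infty\frac{(-1)^k}{k^2 2^k}-\frac{\log 2}{2},\qquad a_{11}=\tfrac12+\log 2,\qquad a_{1,k+1}=\frac1k+\frac{(-1)^k}{2^{k+1}}-\frac1{k2^k}\ (k\ge 1), \] and, for $r\ge 1$, \[ a_{r+1,0}=\frac{(-1)^r}{r}\sum_{j=r}^\infty\frac1{j3^j},\qquad a_{r+1,1}=0,\qquad a_{r+1,k+1}=\binom kr\left(\frac{(-1)^{k-r}}{2^{k+1}}-\frac1{k2^k}\right)\ (k\ge 1), \] where $\binom kr=0$ for $k<r$. For $m\ge 0$ let $\mathbf A_m=(a_{ij})_{0\le i,j\le m}$ be its leading $(m+1)\times(m+1)$ principal submatrix. Then for every $m\ge 7$ the matrix $\mathbf A_m$ has exactly one real eigenvalue $\lambda_m$ in the interval $[1.232891-0.0007,\ 1.232891+0.0007]$; it is simple, that is, of algebraic multiplicity one. Every other complex eigenvalue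 $z$ of $\mathbf A_m$ satisfies $|z|<1.002$. -/

import Mathlib

open scoped BigOperators

noncomputable section

namespace CarParking

/-- `Li₂(-1/2) = ∑_{k ≥ 1} (-1)^k / (k² 2^k)`, approximately `-0.4484`. -/
def dilogNegHalf : ℝ :=
  ∑' k : ℕ, (-1 : ℝ) ^ (k + 1) / (((k : ℝ) + 1) ^ 2 * 2 ^ (k + 1))

/-- The tail `∑_{j ≥ r} 1 / (j 3^j)`, used only for `r ≥ 1`. -/
def logTail (r : ℕ) : ℝ :=
  ∑' i : ℕ, 1 / (((r + i : ℕ) : ℝ) * 3 ^ (r + i))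

/-- Entries of row `1` in column `k + 1`, for `k ≥ 1`. -/
def rowOneEntry (k : ℕ) : ℝ :=
  1 / (k : ℝ) + (-1) ^ k / 2 ^ (k + 1) - 1 / ((k : ℝ) * 2 ^ k)

/-- Entries in row `r + 1` and column `k + 1`, for `r, k ≥ 1`. They vanish for `k < r`
because the binomial coefficient does; as `(-1)^(k-r) = (-1)^(k+r)`, the exponent is
written without subtraction. -/
def blockEntry (r k : ℕ) : ℝ :=
  (k.choose r : ℝ) * ((-1) ^ (k + r) / 2 ^ (k + 1) - 1 / ((k : ℝ) * 2 ^ k))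

/-- The infinite matrix acting on the coefficients `(ℓ, a₀, a₁, a₂, …)` of
`ℓ log t + ∑ a_k (t - 1)^k`. Index `0` belongs to `ℓ`, index `k + 1` to `a_k`. -/
def A : Matrix ℕ ℕ ℝ := Matrix.of fun i j =>
  match i, j with
  | 0, 0 => 1 / 2
  | 0, 1 => -1
  | 0, _ + 2 => 0
  | 1, 0 => Real.pi ^ 2 / 12 + dilogNegHalf - Real.log 2 / 2
  | 1, 1 => 1 / 2 + Real.log 2
  | 1, k + 2 => rowOneEntry (k + 1)
  | r + 2, 0 => (-1) ^ (r + 1) / ((r + 1 : ℕ) : ℝ) * logTail (r + 1)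
  | _ + 2, 1 => 0
  | r + 2, k + 2 => blockEntry (r + 1) (k + 1)

/-- The `(m + 1) × (m + 1)` leading principal submatrix of `A`. -/
def truncA (m : ℕ) : Matrix (Fin (m + 1)) (Fin (m + 1)) ℝ :=
  A.submatrix (fun i => (i : ℕ)) (fun j => (j : ℕ))

/-- `truncA m` with its entries regarded as complex numbers. -/
def truncAC (m : ℕ) : Matrix (Fin (m + 1)) (Fin (m + 1)) ℂ :=
  (truncA m).map (fun x : ℝ => (x : ℂ))

end CarParking

end

/-!
A left eigenvector `x` of a truncation `M` for `z` splits as `(a, b, s)`, where `s` is indexed like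
the block `B = powToPow`. The absolute column sums of `B` are at most `1 / 2`, because
`∑ r, k.choose r = 2 ^ k` and the alternating sum vanishes. Hence `z - B` is invertible for
`1 / 2 < ‖z‖`, so `b ≠ 0`, and after normalising `b = 1` the vector `x` is determined by `z`, which
is a zero of the determinant of a `2 × 2` Schur complement. Enlarging the truncation changes this
function of `z` by a geometrically small amount, so that its signs at the ends of the interval are
those for a small truncation, and it has a zero `λ` in between.

Let `x` be the normalised left eigenvector for `λ`. If `u` is the one for another eigenvalue `z`,
then `y = (u - x) / (z - λ)` satisfies `y M = z y + x` and its entry in position `b` is `0`; a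
generalised eigenvector of `λ`, corrected by a multiple of `x`, has the same property with `z = λ`.
For such a `y`, columns `0` and `1` of the equation give `z = 1 + log 2 - λ - s' ⬝ ℓ`, where `ℓ` is
the part of column `0` below row `1` and `s'`, the corresponding part of `y`, is bounded by a
multiple of `(‖z‖ - 1 / 2)⁻¹`. This forces `‖z‖ < 9 / 10 < λ`, so `λ` is simple and every other
eigenvalue is small.
-/

namespace CarParking

open Finset Matrix Module

section LinearAlgebra

variable {R M K V ι : Type*}

theorem hasEigenvalue_toLin'_map [Field K] [Field R] [Fintype ι] [DecidableEq ι]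
    (B : Matrix ι ι K) (f : K →+* R) (t : K) :
    End.HasEigenvalue (B.map f).toLin' (f t) ↔ End.HasEigenvalue B.toLin' t := by
  simp only [End.hasEigenvalue_iff_isRoot_charpoly, charpoly_toLin', charpoly_map,
    Polynomial.isRoot_map_iff f.injective]

theorem hasEigenvalue_toLin'_transpose [Field K] [Fintype ι] [DecidableEq ι]
    (B : Matrix ι ι K) (z : K) :
    End.HasEigenvalue Bᵀ.toLin' z ↔ End.HasEigenvalue B.toLin' z := by
  simp only [End.hasEigenvalue_iff_isRoot_charpoly, charpoly_toLin', charpoly_transpose]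

theorem hasEigenvalue_toLin'_iff_exists_vecMul [Field K] [Fintype ι] [DecidableEq ι]
    {B : Matrix ι ι K} {z : K} :
    End.HasEigenvalue B.toLin' z ↔ ∃ x ≠ 0, x ᵥ* B = z • x := by
  rw [← hasEigenvalue_toLin'_transpose]
  constructor
  · intro h
    obtain ⟨x, hx, hx0⟩ := h.exists_hasEigenvector
    rw [End.mem_eigenspace_iff, toLin'_apply, mulVec_transpose] at hx
    exact ⟨x, hx0, hx⟩
  · rintro ⟨x, hx0, hx⟩
    refine End.hasEigenvalue_of_hasEigenvector (x := x) ⟨?_, hx0⟩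
    rwa [End.mem_eigenspace_iff, toLin'_apply, mulVec_transpose]

theorem maxGenEigenspace_eq_eigenspace [CommRing R] [AddCommGroup M] [Module R M] {f : End R M}
    {μ : R} (hchain : ∀ x y, f x = μ • x → f y = μ • y + x → x = 0) :
    f.maxGenEigenspace μ = f.eigenspace μ := by
  have apply_sub (y : M) : (f - μ • 1) y = f y - μ • y := rfl
  have of_pow_eq_zero (k : ℕ) (y : M) (hy : ((f - μ • 1) ^ k) y = 0) : (f - μ • 1) y = 0 := by
    induction k generalizing y with
    | zero => rw [show y = 0 from hy, map_zero]
    | succ k ih =>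
      refine hchain _ y (sub_eq_zero.1 ?_) ?_
      · rw [← apply_sub]
        exact ih _ (by rwa [pow_succ, End.mul_apply] at hy)
      · rw [apply_sub, add_sub_cancel]
  refine le_antisymm (fun y hy => ?_) End.eigenspace_le_maxGenEigenspace
  obtain ⟨k, hk⟩ := (f.mem_maxGenEigenspace μ y).1 hy
  rw [End.mem_eigenspace_iff, ← sub_eq_zero]
  exact of_pow_eq_zero k y hk

variable [Field K] [AddCommGroup V] [Module K V]

theorem finrank_eigenspace_eq_one {f : End K V} {μ : K} (φ : V →ₗ[K] K) (hf : f.HasEigenvalue μ)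
    (hφ : ∀ x, f x = μ • x → φ x = 0 → x = 0) : finrank K (f.eigenspace μ) = 1 := by
  obtain ⟨e, he, he0⟩ := hf.exists_hasEigenvector
  have hφe : φ e ≠ 0 := fun h => he0 (hφ e (End.mem_eigenspace_iff.1 he) h)
  refine finrank_eq_one_iff'.2 ⟨⟨e, he⟩, by simpa using he0, fun x => ⟨φ x / φ e, ?_⟩⟩
  have hmem : (φ x / φ e) • e - x ∈ f.eigenspace μ :=
    sub_mem (Submodule.smul_mem _ _ he) x.2
  refine Subtype.ext (sub_eq_zero.1 (hφ _ (End.mem_eigenspace_iff.1 hmem) ?_))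
  change φ ((φ x / φ e) • e - x) = 0
  rw [map_sub, map_smul, smul_eq_mul, div_mul_cancel₀ _ hφe, sub_self]

theorem rootMultiplicity_charpoly_eq_one [FiniteDimensional K V] {f : End K V} {μ : K}
    (φ : V →ₗ[K] K) (hf : f.HasEigenvalue μ) (hφ : ∀ x, f x = μ • x → φ x = 0 → x = 0)
    (hchain : ∀ x y, f x = μ • x → φ x = 1 → f y = μ • y + x → φ y ≠ 0) :
    f.charpoly.rootMultiplicity μ = 1 := by
  rw [← LinearMap.finrank_maxGenEigenspace_eq, maxGenEigenspace_eq_eigenspace,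
    finrank_eigenspace_eq_one φ hf hφ]
  intro x y hx hy
  by_contra hx0
  have hφx : φ x ≠ 0 := fun h => hx0 (hφ x hx h)
  refine hchain ((φ x)⁻¹ • x) ((φ x)⁻¹ • (y - (φ y / φ x) • x)) ?_ ?_ ?_ ?_
  · rw [map_smul, hx, smul_comm]
  · rw [map_smul, smul_eq_mul, inv_mul_cancel₀ hφx]
  · rw [map_smul, map_sub, map_smul, hy, hx]
    module
  · rw [map_smul, map_sub, map_smul, smul_eq_mul (φ y / φ x), div_mul_cancel₀ _ hφx, sub_self,
      smul_zero]

end LinearAlgebra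

section SupNorm

variable {R 𝕜 ι κ : Type*} [Fintype ι] [Fintype κ]

theorem norm_dotProduct_le [NonUnitalSeminormedRing R] (s v : ι → R) :
    ‖s ⬝ᵥ v‖ ≤ ‖s‖ * ∑ i, ‖v i‖ := by
  rw [dotProduct, mul_sum]
  refine norm_sum_le_of_le _ fun i _ => (norm_mul_le _ _).trans ?_
  exact mul_le_mul_of_nonneg_right (norm_le_pi_norm s i) (norm_nonneg _)

theorem norm_vecMul_le [NonUnitalSeminormedRing R] {B : Matrix ι κ R} {c : ℝ} (hc : 0 ≤ c)
    (hB : ∀ k, ∑ i, ‖B i k‖ ≤ c) (s : ι → R) : ‖s ᵥ* B‖ ≤ ‖s‖ * c := by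
  refine (pi_norm_le_iff_of_nonneg (by positivity)).2 fun k => ?_
  exact (norm_dotProduct_le s (B.col k)).trans (mul_le_mul_of_nonneg_left (hB k) (norm_nonneg s))

theorem sub_mul_norm_le_of_smul_eq_add_vecMul [NormedField 𝕜] {B : Matrix ι ι 𝕜} {c : ℝ}
    (hc : 0 ≤ c) (hB : ∀ k, ∑ i, ‖B i k‖ ≤ c) {z : 𝕜} {s g : ι → 𝕜} (h : z • s = g + s ᵥ* B) :
    (‖z‖ - c) * ‖s‖ ≤ ‖g‖ := by
  have hle : ‖z‖ * ‖s‖ ≤ ‖g‖ + ‖s‖ * c :=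
    calc ‖z‖ * ‖s‖ = ‖g + s ᵥ* B‖ := by rw [← norm_smul, h]
      _ ≤ ‖g‖ + ‖s‖ * c := (norm_add_le _ _).trans (by gcongr; exact norm_vecMul_le hc hB s)
  linarith

end SupNorm

section ForwardSubstitution

variable {K : Type*} [Field K]

/-- The row vector `w` with `w (t - B) = g`, for an upper triangular `B`, computed by forward
substitution. An infinite `B` is allowed since `w k` depends only on the first `k + 1` columns. -/
noncomputable def forwardSubst (B : Matrix ℕ ℕ K) (g : ℕ → K) (t : K) : ℕ → K
  | k => (g k + ∑ i : Fin k, forwardSubst B g t i * B i k) / (t - B k k)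
termination_by k => k
decreasing_by exact i.2

theorem forwardSubst_eq (B : Matrix ℕ ℕ K) (g : ℕ → K) (t : K) (k : ℕ) :
    forwardSubst B g t k =
      (g k + ∑ i ∈ range k, forwardSubst B g t i * B i k) / (t - B k k) := by
  rw [forwardSubst, Fin.sum_univ_eq_sum_range fun i => forwardSubst B g t i * B i k]

theorem mul_forwardSubst {B : Matrix ℕ ℕ K} (hB : B.BlockTriangular id) (g : ℕ → K) {t : K}
    {n k : ℕ} (hk : k < n) (ht : t ≠ B k k) :
    t * forwardSubst B g t k = g k + ∑ i ∈ range n, forwardSubst B g t i * B i k := by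
  have hsum : ∑ i ∈ range n, forwardSubst B g t i * B i k =
      ∑ i ∈ range k, forwardSubst B g t i * B i k + forwardSubst B g t k * B k k := by
    rw [← sum_range_succ]
    refine (sum_subset (range_mono hk) fun i _ hi => ?_).symm
    rw [hB (show id k < id i by simpa using hi), mul_zero]
  have hdiv : forwardSubst B g t k * (t - B k k) =
      g k + ∑ i ∈ range k, forwardSubst B g t i * B i k := by
    rw [forwardSubst_eq, div_mul_cancel₀ _ (sub_ne_zero.2 ht)]
  linear_combination hdiv - hsum

theorem continuousOn_forwardSubst [TopologicalSpace K] [IsTopologicalDivisionRing K]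
    (B : Matrix ℕ ℕ K) (g : ℕ → K) {S : Set K} (hS : ∀ t ∈ S, ∀ k, t ≠ B k k) (k : ℕ) :
    ContinuousOn (fun t => forwardSubst B g t k) S := by
  induction k using Nat.strong_induction_on with
  | _ k ih =>
    simp_rw [forwardSubst_eq B g _ k]
    refine .div (continuousOn_const.add (continuousOn_finsetSum _ fun i hi => ?_)) (by fun_prop)
      fun t ht => sub_ne_zero.2 (hS t ht k)
    exact (ih i (mem_range.1 hi)).mul continuousOn_const

end ForwardSubstitution

/-! ### The entries of `A` -/

theorem logTail_term_le {r : ℕ} (hr : 1 ≤ r) (i : ℕ) :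
    1 / (((r + i : ℕ) : ℝ) * 3 ^ (r + i)) ≤ 1 / ((r : ℝ) * 3 ^ r) * (1 / 3) ^ i := by
  have : (0 : ℝ) < r := by exact_mod_cast hr
  rw [div_pow, one_pow, div_mul_div_comm, one_mul, pow_add, mul_assoc]
  gcongr
  exact Nat.le_add_right r i

theorem hasSum_mul_geometric_third (a : ℝ) :
    HasSum (fun i : ℕ => a * (1 / 3) ^ i) (a * (3 / 2)) := by
  have h := hasSum_geometric_of_lt_one (r := (1 / 3 : ℝ)) (by norm_num) (by norm_num)
  norm_num only at h
  exact h.mul_left a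

theorem summable_logTail {r : ℕ} (hr : 1 ≤ r) :
    Summable fun i : ℕ => 1 / (((r + i : ℕ) : ℝ) * 3 ^ (r + i)) :=
  .of_nonneg_of_le (fun _ => by positivity) (logTail_term_le hr)
    (hasSum_mul_geometric_third _).summable

theorem logTail_nonneg (r : ℕ) : 0 ≤ logTail r :=
  tsum_nonneg fun _ => by positivity

theorem logTail_le {r : ℕ} (hr : 1 ≤ r) : logTail r ≤ 1 / (r * 3 ^ r) * (3 / 2) :=
  hasSum_le (logTail_term_le hr) (summable_logTail hr).hasSum (hasSum_mul_geometric_third _)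

theorem logTail_eq_add_succ {r : ℕ} (hr : 1 ≤ r) :
    logTail r = 1 / ((r : ℝ) * 3 ^ r) + logTail (r + 1) := by
  rw [logTail, (summable_logTail hr).tsum_eq_zero_add, logTail, add_zero]
  simp only [add_assoc, add_comm 1]
/-- The column `(a_{i+2,0})_i` of `A`: the coefficients of `log t` on the powers
`(t - 1)^(i + 1)`. -/
noncomputable def logToPow (i : ℕ) : ℝ := A (i + 2) 0

/-- The entry `a_{1,0}` of `A`: the coefficient of `log t` on the constants. -/
noncomputable def logToConst : ℝ := A 1 0

/-- The row `(a_{1,k+2})_k` of `A`: the coefficients of the powers `(t - 1)^(k + 1)` on the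
constants. -/
noncomputable def powToConst (k : ℕ) : ℝ := A 1 (k + 2)

/-- The block `(a_{i+2,k+2})_{i,k}` of `A`: its action on the powers `(t - 1)^(k + 1)`. -/
noncomputable def powToPow : Matrix ℕ ℕ ℝ := A.submatrix (· + 2) (· + 2)

theorem powToPow_apply (i k : ℕ) : powToPow i k = blockEntry (i + 1) (k + 1) := rfl

theorem abs_logToPow_le (i : ℕ) :
    |logToPow i| ≤ 1 / (((i : ℝ) + 1) ^ 2 * 3 ^ (i + 1)) * (3 / 2) := by
  have habs : |logToPow i| = 1 / ((i : ℝ) + 1) * logTail (i + 1) := by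
    change |(-1 : ℝ) ^ (i + 1) / ((i + 1 : ℕ) : ℝ) * logTail (i + 1)| = _
    rw [abs_mul, abs_div, abs_neg_one_pow, abs_of_nonneg (logTail_nonneg _), Nat.abs_cast,
      Nat.cast_succ]
  calc |logToPow i| ≤ 1 / ((i : ℝ) + 1) * (1 / (((i + 1 : ℕ) : ℝ) * 3 ^ (i + 1)) * (3 / 2)) := by
        rw [habs]
        gcongr
        exact logTail_le (by omega)
    _ = 1 / (((i : ℝ) + 1) ^ 2 * 3 ^ (i + 1)) * (3 / 2) := by
        push_cast
        field_simp

theorem sum_range_abs_logToPow_add_le (N n : ℕ) :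
    ∑ i ∈ range n, |logToPow (N + i)| ≤ 1 / (((N : ℝ) + 1) ^ 2 * 3 ^ (N + 1)) * (9 / 4) := by
  have term_le (i : ℕ) : |logToPow (N + i)| ≤
      1 / (((N : ℝ) + 1) ^ 2 * 3 ^ (N + 1)) * (3 / 2) * (1 / 3) ^ i := by
    calc |logToPow (N + i)|
        ≤ 1 / ((((N + i : ℕ) : ℝ) + 1) ^ 2 * 3 ^ (N + i + 1)) * (3 / 2) := abs_logToPow_le _
      _ ≤ 1 / (((N : ℝ) + 1) ^ 2 * 3 ^ (N + i + 1)) * (3 / 2) := by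
        gcongr
        exact Nat.le_add_right N i
      _ = 1 / (((N : ℝ) + 1) ^ 2 * 3 ^ (N + 1)) * (3 / 2) * (1 / 3) ^ i := by
        rw [Nat.add_right_comm, pow_add, div_pow, one_pow]
        field_simp
  calc ∑ i ∈ range n, |logToPow (N + i)|
      ≤ ∑ i ∈ range n, 1 / (((N : ℝ) + 1) ^ 2 * 3 ^ (N + 1)) * (3 / 2) * (1 / 3) ^ i :=
        sum_le_sum fun i _ => term_le i
    _ ≤ 1 / (((N : ℝ) + 1) ^ 2 * 3 ^ (N + 1)) * (3 / 2) * (3 / 2) :=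
        sum_le_hasSum _ (fun _ _ => by positivity) (hasSum_mul_geometric_third _)
    _ = 1 / (((N : ℝ) + 1) ^ 2 * 3 ^ (N + 1)) * (9 / 4) := by ring

theorem abs_powToConst_le (k : ℕ) : |powToConst k| ≤ 1 / 2 := by
  change |1 / ((k + 1 : ℕ) : ℝ) + (-1) ^ (k + 1) / 2 ^ (k + 1 + 1) -
    1 / (((k + 1 : ℕ) : ℝ) * 2 ^ (k + 1))| ≤ 1 / 2
  match k with
  | 0 => norm_num [abs_le]
  | 1 => norm_num [abs_le]
  | k + 2 =>
    have two_pow_ge : (1 : ℝ) ≤ 2 ^ k := one_le_pow₀ one_le_two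
    have hsign : |(-1 : ℝ) ^ (k + 2 + 1) / 2 ^ (k + 2 + 1 + 1)| ≤ 1 / 16 := by
      rw [abs_div, abs_neg_one_pow, abs_of_pos (by positivity)]
      have hpow : (2 : ℝ) ^ (k + 2 + 1 + 1) = 2 ^ k * 16 := by ring
      gcongr
      linarith
    have hinv : (1 : ℝ) / ((k + 2 + 1 : ℕ) : ℝ) ≤ 1 / 3 := by
      gcongr
      exact_mod_cast Nat.le_add_left 3 k
    have hprod : (1 : ℝ) / (((k + 2 + 1 : ℕ) : ℝ) * 2 ^ (k + 2 + 1)) ≤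
        1 / ((k + 2 + 1 : ℕ) : ℝ) := by
      gcongr
      exact le_mul_of_one_le_right (by positivity) (one_le_pow₀ one_le_two)
    have hprod_nonneg : (0 : ℝ) ≤ 1 / (((k + 2 + 1 : ℕ) : ℝ) * 2 ^ (k + 2 + 1)) := by positivity
    obtain ⟨hsign_lower, hsign_upper⟩ := abs_le.1 hsign
    exact abs_le.2 ⟨by linarith, by linarith⟩

theorem blockEntry_eq_zero {r k : ℕ} (h : k < r) : blockEntry r k = 0 := by
  rw [blockEntry, Nat.choose_eq_zero_of_lt h, Nat.cast_zero, zero_mul]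

theorem blockTriangular_powToPow : powToPow.BlockTriangular id := fun _ _ h =>
  blockEntry_eq_zero (Nat.succ_lt_succ h)

theorem abs_blockEntry {k : ℕ} (hk : 2 ≤ k) (r : ℕ) :
    |blockEntry r k| =
      (k.choose r : ℝ) / 2 ^ (k + 1) - (-1) ^ k * ((-1) ^ r * k.choose r) / (k * 2 ^ k) := by
  have hk_real : (2 : ℝ) ≤ k := by exact_mod_cast hk
  have hle : (1 : ℝ) / (k * 2 ^ k) ≤ 1 / 2 ^ (k + 1) := by
    rw [pow_succ']
    gcongr
  have hnonneg : (0 : ℝ) ≤ 1 / (k * 2 ^ k) := by positivity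
  rw [blockEntry, abs_mul, Nat.abs_cast, ← mul_assoc, ← pow_add]
  rcases neg_one_pow_eq_or ℝ (k + r) with h | h <;> rw [h]
  · rw [abs_of_nonneg (by linarith)]
    ring
  · rw [abs_of_nonpos (by rw [neg_div]; linarith)]
    ring

theorem sum_range_succ_abs_blockEntry {k : ℕ} (hk : 2 ≤ k) :
    ∑ r ∈ range (k + 1), |blockEntry r k| = 1 / 2 := by
  have hchoose : ∑ r ∈ range (k + 1), (k.choose r : ℝ) = 2 ^ k := by
    exact_mod_cast Nat.sum_range_choose k
  have halternating : ∑ r ∈ range (k + 1), (-1 : ℝ) ^ r * k.choose r = 0 := by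
    exact_mod_cast Int.alternating_sum_range_choose_of_ne (by omega : k ≠ 0)
  simp_rw [abs_blockEntry hk]
  rw [sum_sub_distrib, ← sum_div, ← sum_div, ← mul_sum, hchoose, halternating, pow_succ]
  field_simp
  ring

theorem sum_range_abs_powToPow_le (n k : ℕ) : ∑ i ∈ range n, |powToPow i k| ≤ 1 / 2 := by
  have hzero (i : ℕ) (hi : i ∉ range (k + 1)) : |powToPow i k| = 0 := by
    rw [powToPow_apply, blockEntry_eq_zero (by simpa using hi), abs_zero]
  calc ∑ i ∈ range n, |powToPow i k|
      ≤ ∑ i ∈ range (max n (k + 1)), |powToPow i k| :=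
        sum_le_sum_of_subset_of_nonneg (range_mono (le_max_left _ _)) fun _ _ _ => abs_nonneg _
    _ = ∑ i ∈ range (k + 1), |powToPow i k| :=
        (sum_subset (range_mono (le_max_right _ _)) fun i _ => hzero i).symm
    _ ≤ 1 / 2 := by
        rcases Nat.eq_zero_or_pos k with rfl | hk
        · norm_num [powToPow_apply, blockEntry]
        · have hsum := sum_range_succ_abs_blockEntry (Nat.succ_le_succ hk)
          rw [sum_range_succ'] at hsum
          simp only [powToPow_apply]
          linarith [abs_nonneg (blockEntry 0 (k + 1))]

theorem abs_powToPow_self_le (k : ℕ) : |powToPow k k| ≤ 1 / 2 :=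
  (single_le_sum (f := fun i => |powToPow i k|) (fun _ _ => abs_nonneg _)
    (self_mem_range_succ k)).trans (sum_range_abs_powToPow_le (k + 1) k)

theorem ne_powToPow_self {t : ℝ} (ht : 1 / 2 < t) (k : ℕ) : t ≠ powToPow k k :=
  (((le_abs_self _).trans (abs_powToPow_self_le k)).trans_lt ht).ne'

/-! ### Left multiplication by the truncations -/

/-- The first `n` terms of a real sequence, as a complex row vector. -/
noncomputable def truncVec (n : ℕ) (v : ℕ → ℝ) : Fin n → ℂ := fun i => (v i : ℂ)

/-- The leading `n × n` submatrix of a real infinite matrix, with complex entries. -/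
noncomputable def truncMatrix (n : ℕ) (B : Matrix ℕ ℕ ℝ) : Matrix (Fin n) (Fin n) ℂ :=
  of fun i k => (B i k : ℂ)

theorem norm_truncVec_le {v : ℕ → ℝ} {c : ℝ} (hc : 0 ≤ c) (hv : ∀ i, |v i| ≤ c) (n : ℕ) :
    ‖truncVec n v‖ ≤ c :=
  (pi_norm_le_iff_of_nonneg hc).2 fun i => (Complex.norm_real _).trans_le (hv i)

theorem smul_truncVec_forwardSubst {B : Matrix ℕ ℕ ℝ} (hB : B.BlockTriangular id) (g : ℕ → ℝ)
    {t : ℝ} (ht : ∀ k, t ≠ B k k) (n : ℕ) :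
    (t : ℂ) • truncVec n (forwardSubst B g t) =
      truncVec n g + truncVec n (forwardSubst B g t) ᵥ* truncMatrix n B := by
  funext k
  have h := mul_forwardSubst hB g k.2 (ht k)
  rw [← Fin.sum_univ_eq_sum_range fun i => forwardSubst B g t i * B i k] at h
  simp only [Pi.add_apply, Pi.smul_apply, smul_eq_mul, truncVec, truncMatrix, vecMul, dotProduct,
    of_apply]
  exact_mod_cast h

theorem cons_cons_vecMul_truncAC {n : ℕ} (a b : ℂ) (s : Fin n → ℂ) :
    vecCons a (vecCons b s) ᵥ* truncAC (n + 1) =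
      vecCons (a / 2 + b * logToConst + s ⬝ᵥ truncVec n logToPow)
        (vecCons (-a + b * (1 / 2 + Real.log 2 : ℝ))
          (b • truncVec n powToConst + s ᵥ* truncMatrix n powToPow)) := by
  funext j
  refine Fin.cases ?_ (fun j => Fin.cases ?_ (fun k => ?_) j) j <;>
    simp [vecMul, dotProduct, Fin.sum_univ_succ, truncAC, truncA, truncVec, truncMatrix,
      logToConst, logToPow, powToConst, powToPow, A, div_eq_mul_inv, add_assoc]

/-! ### Numerical bounds -/

theorem abs_dilogNegHalf_sub_sum_le (N : ℕ) :
    |dilogNegHalf - ∑ k ∈ range N, (-1 : ℝ) ^ (k + 1) / (((k : ℝ) + 1) ^ 2 * 2 ^ (k + 1))| ≤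
      1 / (((N : ℝ) + 1) ^ 2 * 2 ^ N) := by
  set term : ℕ → ℝ := fun k => (-1) ^ (k + 1) / (((k : ℝ) + 1) ^ 2 * 2 ^ (k + 1)) with hterm
  have term_le (N k : ℕ) : ‖term (k + N)‖ ≤ 1 / (((N : ℝ) + 1) ^ 2 * 2 ^ N) / 2 / 2 ^ k := by
    calc ‖term (k + N)‖ = 1 / ((((k + N : ℕ) : ℝ) + 1) ^ 2 * 2 ^ (k + N + 1)) := by
          rw [hterm, norm_div, norm_pow, norm_neg, norm_one, one_pow,
            Real.norm_of_nonneg (by positivity)]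
      _ ≤ 1 / (((N : ℝ) + 1) ^ 2 * 2 ^ (k + N + 1)) := by
          gcongr
          exact Nat.le_add_left N k
      _ = 1 / (((N : ℝ) + 1) ^ 2 * 2 ^ N) / 2 / 2 ^ k := by
          rw [pow_succ 2, pow_add 2 k, mul_comm (2 ^ k)]
          field_simp
  have hsummable : Summable term :=
    .of_norm_bounded (summable_geometric_two' _) (term_le 0)
  rw [dilogNegHalf, ← hsummable.sum_add_tsum_nat_add N, add_sub_cancel_left, ← Real.norm_eq_abs]
  exact tsum_of_norm_bounded (hasSum_geometric_two' _) (term_le N)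

theorem logToConst_mem_Icc : logToConst ∈ Set.Icc (0.02745 : ℝ) 0.0275 := by
  have hdilog := abs_le.1 (abs_dilogNegHalf_sub_sum_le 10)
  norm_num [sum_range_succ] at hdilog
  have hpi_sq_lower : (3.141592 : ℝ) ^ 2 ≤ Real.pi ^ 2 := by
    gcongr
    exact Real.pi_gt_d6.le
  have hpi_sq_upper : Real.pi ^ 2 ≤ (3.141593 : ℝ) ^ 2 := by
    gcongr
    exact Real.pi_lt_d6.le
  change Real.pi ^ 2 / 12 + dilogNegHalf - Real.log 2 / 2 ∈ _
  constructor <;> linarith [hdilog.1, hdilog.2, Real.log_two_gt_d9, Real.log_two_lt_d9]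

theorem logToPow_mem_Icc :
    logToPow 0 ∈ Set.Icc (-0.4055 : ℝ) (-0.4053) ∧ logToPow 1 ∈ Set.Icc (0.036 : ℝ) 0.0361 ∧
      logToPow 2 ∈ Set.Icc (-0.00553 : ℝ) (-0.00549) ∧
      logToPow 3 ∈ Set.Icc (0.00103 : ℝ) 0.00108 := by
  have hrec (r : ℕ) := logTail_eq_add_succ (Nat.le_add_left 1 r)
  have hupper := logTail_le (r := 7) (by norm_num)
  have htail_one := hrec 0
  have htail_two := hrec 1
  have htail_three := hrec 2
  have htail_four := hrec 3
  have htail_five := hrec 4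
  have htail_six := hrec 5
  norm_num at htail_one htail_two htail_three htail_four htail_five htail_six hupper
  refine ⟨?_, ?_, ?_, ?_⟩ <;> norm_num [logToPow, A] <;> constructor <;>
    linarith [logTail_nonneg 7]

/-! ### The Schur complement -/

/-- The row vector `w` with `w (t - B) = g`, where `B = powToPow` and `g = powToConst`. -/
noncomputable def leftSol (t : ℝ) : ℕ → ℝ := forwardSubst powToPow powToConst t

/-- The determinant of the Schur complement of `t - B` in `t - truncA (n + 1)`, where `B` is the
leading `n × n` submatrix of `powToPow`: an eigenvalue `t > 1 / 2` of `truncA (n + 1)` is a zero. -/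
noncomputable def schur (n : ℕ) (t : ℝ) : ℝ :=
  (t - 1 / 2) * (t - (1 / 2 + Real.log 2)) + logToConst +
    ∑ i ∈ range n, leftSol t i * logToPow i

theorem leftSol_eq (t : ℝ) (k : ℕ) :
    leftSol t k =
      (rowOneEntry (k + 1) + ∑ i ∈ range k, leftSol t i * blockEntry (i + 1) (k + 1)) /
        (t - blockEntry (k + 1) (k + 1)) :=
  forwardSubst_eq _ _ _ _

theorem leftSol_zero (t : ℝ) : leftSol t 0 = 1 / 4 / (t + 1 / 4) := by
  rw [leftSol_eq]
  norm_num [rowOneEntry, blockEntry]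

theorem leftSol_one (t : ℝ) : leftSol t 1 = (1 / 2 - leftSol t 0 / 2) / t := by
  rw [leftSol_eq]
  norm_num [rowOneEntry, blockEntry]
  ring

theorem leftSol_two (t : ℝ) :
    leftSol t 2 = (11 / 48 + leftSol t 0 / 16 - 5 * leftSol t 1 / 16) / (t - 1 / 48) := by
  rw [leftSol_eq]
  norm_num [sum_range_succ, rowOneEntry, blockEntry, Nat.choose]
  ring

theorem leftSol_three (t : ℝ) :
    leftSol t 3 =
      (17 / 64 - 3 * leftSol t 0 / 16 + 3 * leftSol t 1 / 32 - 3 * leftSol t 2 / 16) /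
        (t - 1 / 64) := by
  rw [leftSol_eq]
  norm_num [sum_range_succ, rowOneEntry, blockEntry, Nat.choose]
  ring

theorem sum_norm_truncMatrix_powToPow_le (n : ℕ) (k : Fin n) :
    ∑ i, ‖truncMatrix n powToPow i k‖ ≤ 1 / 2 := by
  simp only [truncMatrix, of_apply, Complex.norm_real, Real.norm_eq_abs]
  rw [Fin.sum_univ_eq_sum_range fun i => |powToPow i k|]
  exact sum_range_abs_powToPow_le n k

theorem smul_truncVec_leftSol {t : ℝ} (ht : 1 / 2 < t) (n : ℕ) :
    (t : ℂ) • truncVec n (leftSol t) =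
      truncVec n powToConst + truncVec n (leftSol t) ᵥ* truncMatrix n powToPow :=
  smul_truncVec_forwardSubst blockTriangular_powToPow _ (ne_powToPow_self ht) n

theorem sub_half_mul_norm_le {n : ℕ} {z : ℂ} {s g : Fin n → ℂ}
    (h : z • s = g + s ᵥ* truncMatrix n powToPow) : (‖z‖ - 1 / 2) * ‖s‖ ≤ ‖g‖ :=
  sub_mul_norm_le_of_smul_eq_add_vecMul (by norm_num) (sum_norm_truncMatrix_powToPow_le n) h

theorem abs_leftSol_le {t : ℝ} (ht : 1 / 2 < t) (k : ℕ) : |leftSol t k| ≤ 1 / 2 / (t - 1 / 2) := by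
  have hle := (sub_half_mul_norm_le (smul_truncVec_leftSol ht (k + 1))).trans
    (norm_truncVec_le (by norm_num) abs_powToConst_le _)
  rw [Complex.norm_real, Real.norm_of_nonneg (by linarith)] at hle
  rw [le_div_iff₀' (by linarith)]
  refine le_trans ?_ hle
  have hcoord := norm_le_pi_norm (truncVec (k + 1) (leftSol t)) (Fin.last k)
  simp only [truncVec, Fin.val_last, Complex.norm_real, Real.norm_eq_abs] at hcoord
  gcongr

theorem abs_schur_add_sub_le {t : ℝ} (ht : 1 / 2 < t) (N p : ℕ) :
    |schur (N + p) t - schur N t| ≤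
      1 / 2 / (t - 1 / 2) * (1 / (((N : ℝ) + 1) ^ 2 * 3 ^ (N + 1)) * (9 / 4)) := by
  have hdiff : schur (N + p) t - schur N t =
      ∑ i ∈ range p, leftSol t (N + i) * logToPow (N + i) := by
    rw [schur, schur, sum_range_add]
    ring
  have : 0 < t - 1 / 2 := by linarith
  calc |schur (N + p) t - schur N t|
      ≤ ∑ i ∈ range p, |leftSol t (N + i)| * |logToPow (N + i)| := by
        rw [hdiff]
        exact (abs_sum_le_sum_abs _ _).trans_eq (sum_congr rfl fun _ _ => abs_mul _ _)
    _ ≤ ∑ i ∈ range p, 1 / 2 / (t - 1 / 2) * |logToPow (N + i)| := by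
        gcongr
        exact abs_leftSol_le ht _
    _ ≤ _ := by
        rw [← mul_sum]
        gcongr
        exact sum_range_abs_logToPow_add_le N p

theorem continuousOn_schur (n : ℕ) : ContinuousOn (schur n) (Set.Ioi (1 / 2)) := by
  refine .add (by fun_prop) (continuousOn_finsetSum _ fun k _ => ?_)
  exact (continuousOn_forwardSubst _ _ (fun _ ht => ne_powToPow_self ht) k).mul continuousOn_const

theorem abs_schur_sub_schur_four_le {t : ℝ} (ht : 6 / 5 ≤ t) {n : ℕ} (hn : 4 ≤ n) :
    |schur n t - schur 4 t| ≤ 0.0003 := by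
  obtain ⟨p, rfl⟩ := Nat.exists_eq_add_of_le hn
  have hcoeff : 1 / 2 / (t - 1 / 2) ≤ (1 / 2 / (6 / 5 - 1 / 2) : ℝ) := by gcongr
  refine (abs_schur_add_sub_le (by linarith) 4 p).trans ?_
  norm_num at hcoeff ⊢
  linarith

theorem schur_left_neg {n : ℕ} (hn : 2 ≤ n) : schur n (1.232891 - 0.0007) < 0 := by
  obtain ⟨⟨-, hpow_zero⟩, ⟨-, hpow_one⟩, ⟨-, hpow_two⟩, -, hpow_three⟩ := logToPow_mem_Icc
  have hconst := logToConst_mem_Icc.2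
  have hlog := Real.log_two_gt_d9
  obtain rfl | rfl | hn : n = 2 ∨ n = 3 ∨ 4 ≤ n := by omega
  · norm_num [schur, sum_range_succ, leftSol_zero, leftSol_one]
    linarith
  · norm_num [schur, sum_range_succ, leftSol_zero, leftSol_one, leftSol_two]
    linarith
  · have hfour : schur 4 (1.232891 - 0.0007) < -0.0003 := by
      norm_num [schur, sum_range_succ, leftSol_zero, leftSol_one, leftSol_two, leftSol_three]
      linarith
    have htail := abs_le.1 (abs_schur_sub_schur_four_le (t := 1.232891 - 0.0007) (by norm_num) hn)
    linarith [htail.2]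

theorem schur_right_pos {n : ℕ} (hn : 2 ≤ n) : 0 < schur n (1.232891 + 0.0007) := by
  obtain ⟨⟨hpow_zero, -⟩, ⟨hpow_one, -⟩, ⟨hpow_two, -⟩, hpow_three, -⟩ := logToPow_mem_Icc
  have hconst := logToConst_mem_Icc.1
  have hlog := Real.log_two_lt_d9
  obtain rfl | rfl | hn : n = 2 ∨ n = 3 ∨ 4 ≤ n := by omega
  · norm_num [schur, sum_range_succ, leftSol_zero, leftSol_one]
    linarith
  · norm_num [schur, sum_range_succ, leftSol_zero, leftSol_one, leftSol_two]
    linarith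
  · have hfour : 0.0003 < schur 4 (1.232891 + 0.0007) := by
      norm_num [schur, sum_range_succ, leftSol_zero, leftSol_one, leftSol_two, leftSol_three]
      linarith
    have htail := abs_le.1 (abs_schur_sub_schur_four_le (t := 1.232891 + 0.0007) (by norm_num) hn)
    linarith [htail.1]

theorem exists_schur_eq_zero {n : ℕ} (hn : 2 ≤ n) :
    ∃ t ∈ Set.Icc (1.232891 - 0.0007 : ℝ) (1.232891 + 0.0007), schur n t = 0 :=
  intermediate_value_Icc (by norm_num)
    ((continuousOn_schur n).mono fun t ht => lt_of_lt_of_le (by norm_num) ht.1)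
    ⟨(schur_left_neg hn).le, (schur_right_pos hn).le⟩

theorem hasEigenvalue_truncAC_iff (m : ℕ) (t : ℝ) :
    End.HasEigenvalue (truncAC m).toLin' (t : ℂ) ↔ End.HasEigenvalue (truncA m).toLin' t :=
  hasEigenvalue_toLin'_map _ Complex.ofRealHom t

theorem hasEigenvalue_truncA_of_schur_eq_zero {n : ℕ} {t : ℝ} (ht : 1 / 2 < t)
    (hschur : schur n t = 0) : End.HasEigenvalue (truncA (n + 1)).toLin' t := by
  rw [← hasEigenvalue_truncAC_iff]
  refine hasEigenvalue_toLin'_iff_exists_vecMul.2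
    ⟨vecCons (1 / 2 + Real.log 2 - t : ℝ) (vecCons 1 (truncVec n (leftSol t))),
      fun h => one_ne_zero (congrFun h 1), ?_⟩
  have hdot : truncVec n (leftSol t) ⬝ᵥ truncVec n logToPow =
      (∑ i ∈ range n, leftSol t i * logToPow i : ℝ) := by
    rw [← Fin.sum_univ_eq_sum_range fun i => leftSol t i * logToPow i]
    simp only [dotProduct, truncVec, Complex.ofReal_sum, Complex.ofReal_mul]
  rw [cons_cons_vecMul_truncAC, one_smul, ← smul_truncVec_leftSol ht, smul_cons, smul_cons, hdot]
  rw [schur] at hschur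
  congr 1
  · rw [smul_eq_mul]
    norm_cast
    linear_combination hschur
  · congr 1
    rw [smul_eq_mul]
    norm_cast
    ring

/-! ### Eigenvalues outside the disc of radius `1 / 2` -/

theorem eq_zero_of_vecMul_truncAC {n : ℕ} {z : ℂ} (hz : 1 / 2 < ‖z‖) {x : Fin (n + 1 + 1) → ℂ}
    (hx : x ᵥ* truncAC (n + 1) = z • x) (hx1 : x 1 = 0) : x = 0 := by
  obtain ⟨a, x, rfl⟩ := Fin.exists_cons x
  obtain ⟨b, s, rfl⟩ := Fin.exists_cons x
  obtain rfl : b = 0 := hx1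
  change vecCons a (vecCons 0 s) ᵥ* _ = z • vecCons a (vecCons 0 s) at hx
  rw [cons_cons_vecMul_truncAC, smul_cons, smul_cons, vecCons_inj, vecCons_inj, zero_smul] at hx
  obtain ⟨-, ha, hs⟩ := hx
  have hs0 : s = 0 := by
    have hle := sub_half_mul_norm_le hs.symm
    rw [norm_zero] at hle
    exact norm_le_zero_iff.1 (nonpos_of_mul_nonpos_right hle (by linarith))
  have ha0 : a = 0 := by simpa using ha
  rw [ha0, hs0]
  exact (congrArg (vecCons 0) cons_zero_zero).trans cons_zero_zero

theorem exists_vecMul_truncAC_eq_smul {n : ℕ} {z : ℂ} (hz : 1 / 2 < ‖z‖)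
    (h : End.HasEigenvalue (truncAC (n + 1)).toLin' z) :
    ∃ x, x ᵥ* truncAC (n + 1) = z • x ∧ x 1 = 1 := by
  obtain ⟨x, hx0, hx⟩ := hasEigenvalue_toLin'_iff_exists_vecMul.1 h
  have hx1 : x 1 ≠ 0 := fun hx1 => hx0 (eq_zero_of_vecMul_truncAC hz hx hx1)
  exact ⟨(x 1)⁻¹ • x, by rw [smul_vecMul, hx, smul_comm], inv_mul_cancel₀ hx1⟩

theorem exists_smul_eq_of_jordanChain {n : ℕ} {z w : ℂ} {x y : Fin (n + 1 + 1) → ℂ}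
    (hx : x ᵥ* truncAC (n + 1) = w • x) (hx1 : x 1 = 1)
    (hy : y ᵥ* truncAC (n + 1) = z • y + x) (hy1 : y 1 = 0) :
    ∃ s s' : Fin n → ℂ, w • s = truncVec n powToConst + s ᵥ* truncMatrix n powToPow ∧
      z • s' = -s + s' ᵥ* truncMatrix n powToPow ∧
      z = 1 + Real.log 2 - w - s' ⬝ᵥ truncVec n logToPow := by
  obtain ⟨a, x, rfl⟩ := Fin.exists_cons x
  obtain ⟨b, s, rfl⟩ := Fin.exists_cons x
  obtain ⟨a', y, rfl⟩ := Fin.exists_cons y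
  obtain ⟨b', s', rfl⟩ := Fin.exists_cons y
  obtain rfl : b = 1 := hx1
  obtain rfl : b' = 0 := hy1
  change vecCons a (vecCons 1 s) ᵥ* _ = w • vecCons a (vecCons 1 s) at hx
  change vecCons a' (vecCons 0 s') ᵥ* _ = z • vecCons a' (vecCons 0 s') +
    vecCons a (vecCons 1 s) at hy
  rw [cons_cons_vecMul_truncAC, smul_cons, smul_cons, vecCons_inj, vecCons_inj, one_smul] at hx
  rw [cons_cons_vecMul_truncAC, smul_cons, smul_cons, cons_add_cons, cons_add_cons, vecCons_inj,
    vecCons_inj, zero_smul] at hy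
  obtain ⟨-, hx1, hs⟩ := hx
  obtain ⟨hy0, hy1, hs'⟩ := hy
  refine ⟨s, s', hs.symm, ?_, ?_⟩
  · rw [zero_add] at hs'
    rw [hs', neg_add_eq_sub, add_sub_cancel_right]
  · push_cast [smul_eq_mul] at hx1 hy0 hy1
    linear_combination hy0 - hx1 + (1 / 2 - z) * hy1

theorem sub_quarter_mul_norm_apply_zero_le {p : ℕ} {z : ℂ} {s g : Fin (p + 1) → ℂ}
    (h : z • s = g + s ᵥ* truncMatrix (p + 1) powToPow) : (‖z‖ - 1 / 4) * ‖s 0‖ ≤ ‖g 0‖ := by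
  have hcol : (s ᵥ* truncMatrix (p + 1) powToPow) 0 = s 0 * (-1 / 4) := by
    rw [vecMul, dotProduct, Fin.sum_univ_succ, sum_eq_zero fun i _ => ?_, add_zero]
    · norm_num [truncMatrix, powToPow_apply, blockEntry]
    · simp [truncMatrix, blockTriangular_powToPow (Nat.succ_pos i)]
  have h0 : g 0 = z * s 0 - s 0 * (-1 / 4) := by
    rw [← hcol, eq_sub_iff_add_eq]
    exact (congrFun h 0).symm
  calc (‖z‖ - 1 / 4) * ‖s 0‖ = ‖z * s 0‖ - ‖s 0 * (-1 / 4)‖ := by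
        norm_num
        ring
    _ ≤ ‖g 0‖ := by
        rw [h0]
        exact norm_sub_norm_le _ _

theorem norm_dotProduct_logToPow_le {p : ℕ} (s : Fin (p + 1) → ℂ) :
    ‖s ⬝ᵥ truncVec (p + 1) logToPow‖ ≤ ‖s 0‖ / 2 + ‖s‖ / 16 := by
  have hhead : ‖(logToPow 0 : ℂ)‖ ≤ 1 / 2 := by
    rw [Complex.norm_real]
    exact (abs_logToPow_le 0).trans_eq (by norm_num)
  have htail : ∑ i : Fin p, ‖(logToPow (i + 1) : ℂ)‖ ≤ 1 / 16 := by
    simp only [Complex.norm_real, Real.norm_eq_abs, add_comm _ 1]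
    rw [Fin.sum_univ_eq_sum_range fun i => |logToPow (1 + i)|]
    exact (sum_range_abs_logToPow_add_le 1 p).trans_eq (by norm_num)
  have htail_dot : ‖(fun i : Fin p => s i.succ) ⬝ᵥ fun i => (logToPow (i + 1) : ℂ)‖ ≤
      ‖s‖ * (1 / 16) :=
    (norm_dotProduct_le _ _).trans <| mul_le_mul
      ((pi_norm_le_iff_of_nonneg (norm_nonneg s)).2 fun i => norm_le_pi_norm s i.succ) htail
      (by positivity) (norm_nonneg s)
  calc ‖s ⬝ᵥ truncVec (p + 1) logToPow‖
      = ‖s 0 * logToPow 0 + (fun i : Fin p => s i.succ) ⬝ᵥ fun i => (logToPow (i + 1) : ℂ)‖ := by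
        simp only [dotProduct, Fin.sum_univ_succ, truncVec, Fin.val_zero, Fin.val_succ]
    _ ≤ ‖s 0‖ * (1 / 2) + ‖s‖ * (1 / 16) :=
        norm_add_le_of_le ((norm_mul_le _ _).trans (by gcongr)) htail_dot
    _ = ‖s 0‖ / 2 + ‖s‖ / 16 := by ring

theorem norm_lt_of_jordanChain {p : ℕ} {z w : ℂ} (hw : 6 / 5 ≤ ‖w‖)
    (hw_near : ‖1 + Real.log 2 - w‖ ≤ 1 / 2) {x y : Fin (p + 2 + 1) → ℂ}
    (hx : x ᵥ* truncAC (p + 2) = w • x) (hx1 : x 1 = 1)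
    (hy : y ᵥ* truncAC (p + 2) = z • y + x) (hy1 : y 1 = 0) : ‖z‖ < 9 / 10 := by
  by_contra! hz
  obtain ⟨s, s', hs, hs', hz_eq⟩ := exists_smul_eq_of_jordanChain hx hx1 hy hy1
  have hs_norm : (6 / 5 - 1 / 2) * ‖s‖ ≤ 1 / 2 :=
    calc (6 / 5 - 1 / 2) * ‖s‖ ≤ (‖w‖ - 1 / 2) * ‖s‖ := by gcongr
      _ ≤ ‖truncVec (p + 1) powToConst‖ := sub_half_mul_norm_le hs
      _ ≤ 1 / 2 := norm_truncVec_le (by norm_num) abs_powToConst_le _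
  have hs_zero_norm : (6 / 5 - 1 / 4) * ‖s 0‖ ≤ 1 / 4 :=
    calc (6 / 5 - 1 / 4) * ‖s 0‖ ≤ (‖w‖ - 1 / 4) * ‖s 0‖ := by gcongr
      _ ≤ ‖truncVec (p + 1) powToConst 0‖ := sub_quarter_mul_norm_apply_zero_le hs
      _ = 1 / 4 := by norm_num [truncVec, powToConst, A, rowOneEntry]
  have hs'_norm : (9 / 10 - 1 / 2) * ‖s'‖ ≤ ‖s‖ :=
    calc (9 / 10 - 1 / 2) * ‖s'‖ ≤ (‖z‖ - 1 / 2) * ‖s'‖ := by gcongr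
      _ ≤ ‖s‖ := (sub_half_mul_norm_le hs').trans_eq (norm_neg s)
  have hs'_zero_norm : (9 / 10 - 1 / 4) * ‖s' 0‖ ≤ ‖s 0‖ :=
    calc (9 / 10 - 1 / 4) * ‖s' 0‖ ≤ (‖z‖ - 1 / 4) * ‖s' 0‖ := by gcongr
      _ ≤ ‖s 0‖ := (sub_quarter_mul_norm_apply_zero_le hs').trans_eq (norm_neg (s 0))
  have hz_norm : ‖z‖ ≤ 1 / 2 + (‖s' 0‖ / 2 + ‖s'‖ / 16) :=
    calc ‖z‖ = ‖1 + Real.log 2 - w - s' ⬝ᵥ truncVec (p + 1) logToPow‖ := congrArg norm hz_eq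
      _ ≤ 1 / 2 + (‖s' 0‖ / 2 + ‖s'‖ / 16) :=
        norm_sub_le_of_le hw_near (norm_dotProduct_logToPow_le s')
  linarith

theorem norm_lt_of_hasEigenvalue_of_ne {p : ℕ} {z w : ℂ} (hw : 6 / 5 ≤ ‖w‖)
    (hw_near : ‖1 + Real.log 2 - w‖ ≤ 1 / 2)
    (hw_eig : End.HasEigenvalue (truncAC (p + 2)).toLin' w)
    (hz_eig : End.HasEigenvalue (truncAC (p + 2)).toLin' z) (hzw : z ≠ w) : ‖z‖ < 9 / 10 := by
  by_contra! hz
  obtain ⟨x, hx, hx1⟩ := exists_vecMul_truncAC_eq_smul (by linarith) hw_eig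
  obtain ⟨u, hu, hu1⟩ := exists_vecMul_truncAC_eq_smul (by linarith) hz_eig
  refine hz.not_gt (norm_lt_of_jordanChain hw hw_near hx hx1 (y := (z - w)⁻¹ • (u - x)) ?_ ?_)
  · rw [smul_vecMul, sub_vecMul, hu, hx, inv_smul_eq_iff₀ (sub_ne_zero.2 hzw), smul_add,
      smul_comm (z - w) z, smul_inv_smul₀ (sub_ne_zero.2 hzw)]
    module
  · rw [Pi.smul_apply, Pi.sub_apply, hu1, hx1, sub_self, smul_zero]

theorem rootMultiplicity_charpoly_truncAC {p : ℕ} {w : ℂ} (hw : 6 / 5 ≤ ‖w‖)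
    (hw_near : ‖1 + Real.log 2 - w‖ ≤ 1 / 2)
    (hw_eig : End.HasEigenvalue (truncAC (p + 2)).toLin' w) :
    (truncAC (p + 2)).charpoly.rootMultiplicity w = 1 := by
  rw [← charpoly_transpose, ← charpoly_toLin']
  refine rootMultiplicity_charpoly_eq_one (LinearMap.proj 1)
    ((hasEigenvalue_toLin'_transpose _ _).2 hw_eig) ?_ ?_ <;>
    simp only [toLin'_apply, mulVec_transpose]
  · exact fun x hx hx1 => eq_zero_of_vecMul_truncAC (by linarith) hx hx1
  · intro x y hx hx1 hy hy1
    linarith [norm_lt_of_jordanChain hw hw_near hx hx1 hy hy1]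

theorem norm_one_add_log_two_sub_le {t : ℝ} (ht_lower : 6 / 5 ≤ t) (ht_upper : t ≤ 2) :
    ‖(1 + Real.log 2 - t : ℂ)‖ ≤ 1 / 2 := by
  rw [← Complex.ofReal_one, ← Complex.ofReal_add, ← Complex.ofReal_sub, Complex.norm_real,
    Real.norm_eq_abs, abs_le]
  constructor <;> linarith [Real.log_two_gt_d9, Real.log_two_lt_d9]

end CarParking

theorem mainTheorem5_general (m : ℕ) (hm : 3 ≤ m) :
    ∃ lam : ℝ,
      lam ∈ Set.Icc (1.232891 - 0.0007 : ℝ) (1.232891 + 0.0007) ∧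
      Module.End.HasEigenvalue (Matrix.toLin' (CarParking.truncA m)) lam ∧
      (∀ x ∈ Set.Icc (1.232891 - 0.0007 : ℝ) (1.232891 + 0.0007),
        Module.End.HasEigenvalue (Matrix.toLin' (CarParking.truncA m)) x → x = lam) ∧
      (CarParking.truncAC m).charpoly.rootMultiplicity (lam : ℂ) = 1 ∧
      ∀ z : ℂ, Module.End.HasEigenvalue (Matrix.toLin' (CarParking.truncAC m)) z →
        z ≠ (lam : ℂ) → ‖z‖ < 9 / 10 := by
  obtain ⟨p, rfl⟩ := Nat.exists_eq_add_of_le' hm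
  obtain ⟨lam, hlam, hschur⟩ := CarParking.exists_schur_eq_zero (Nat.le_add_left 2 p)
  have le_norm {x : ℝ} (hx : x ∈ Set.Icc (1.232891 - 0.0007 : ℝ) (1.232891 + 0.0007)) :
      6 / 5 ≤ ‖(x : ℂ)‖ :=
    le_trans (by rw [Complex.ofReal_re]; linarith [hx.1]) (Complex.re_le_norm x)
  have hnear := CarParking.norm_one_add_log_two_sub_le (t := lam)
    (by linarith [hlam.1]) (by linarith [hlam.2])
  have heig := CarParking.hasEigenvalue_truncA_of_schur_eq_zero (by linarith [hlam.1]) hschur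
  have heig_complex := (CarParking.hasEigenvalue_truncAC_iff _ _).2 heig
  have hgap (z : ℂ) (hz : Module.End.HasEigenvalue (CarParking.truncAC (p + 3)).toLin' z)
      (hne : z ≠ lam) : ‖z‖ < 9 / 10 :=
    CarParking.norm_lt_of_hasEigenvalue_of_ne (le_norm hlam) hnear heig_complex hz hne
  refine ⟨lam, hlam, heig, fun x hx hx_eig => ?_,
    CarParking.rootMultiplicity_charpoly_truncAC (le_norm hlam) hnear heig_complex, hgap⟩
  by_contra hne
  linarith [le_norm hx, hgap x ((CarParking.hasEigenvalue_truncAC_iff _ _).2 hx_eig)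
    (mod_cast hne)]

theorem mainTheorem5 (m : ℕ) (hm : 7 ≤ m) :
    ∃ lam : ℝ,
      lam ∈ Set.Icc (1.232891 - 0.0007 : ℝ) (1.232891 + 0.0007) ∧
      Module.End.HasEigenvalue (Matrix.toLin' (CarParking.truncA m)) lam ∧
      (∀ x ∈ Set.Icc (1.232891 - 0.0007 : ℝ) (1.232891 + 0.0007),
        Module.End.HasEigenvalue (Matrix.toLin' (CarParking.truncA m)) x → x = lam) ∧
      (CarParking.truncAC m).charpoly.rootMultiplicity (lam : ℂ) = 1 ∧
      ∀ z : ℂ, Module.End.HasEigenvalue (Matrix.toLin' (CarParking.truncAC m)) z →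
        z ≠ (lam : ℂ) → ‖z‖ < 1.002 := by
  obtain ⟨lam, hlam, heig, hunique, hsimple, hgap⟩ := mainTheorem5_general m (by omega)
  exact ⟨lam, hlam, heig, hunique, hsimple, fun z hz hne => (hgap z hz hne).trans (by norm_num)⟩
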